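/- Let $b>1$ be a real number. For $x>0$ let $\mathcal M_b(x)$, the mantissa of $x$ in base $b$, be the unique number in $[1,b)$ such that $x=\mathcal M_b(x)\,b^k$ for some integer $k$, and let $\mu_b$ (Benford's law in base $b$) be the probability measure on $[1,b)$ with $\mu_b([1,a))=\log_b a$ for $1\le a<b$. Let $X_1,X_2,\dots$ be positive random variables on a probability space $(\Omega,\mathcal T,P)$ and put $Y_n=\prod_{k=1}^n X_k$. Suppose that the sequence $(X_n)_{n\ge1}$ is (strictly) stationary, i.e. for every $m\ge 0$ the sequence $(X_{n+m})_{n\ge1}$ has the same law as $(X_n)_{n\ge 1}$, and that $Y_n$ tends to be Benford in base $b$, i.e. the laws of the random variables $\mathcal M_b(Y_n)$ converge weakly to $\mu_b$ as $n\to\infty$. Then $(Y_n)$ is almost surely Benford in base $b$, i.e. for $P$-almost every $\omega$, $$\lim_{N\to\infty}\frac1N\,\#\{\,1\le n\le N:\ \mathcal M_b(Y_n(\omega))\in[1,a)\,\}=\log_b a\qquad\text{for all } a\in[1,b).$$ -/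

import Mathlib

open MeasureTheory ProbabilityTheory Filter Topology

namespace Benford

/-- The mantissa in base `b` of a positive real `x`: the number `x / b ^ k`, where `k` is the integer
with `b ^ k ≤ x < b ^ (k + 1)`. (Only meaningful for `1 < b` and `0 < x`.) -/
noncomputable def mantissa (b x : ℝ) : ℝ := x / b ^ ⌊Real.logb b x⌋

/-- The mantissa of `x > 0` is a number of `[1, b)` that differs from `x` by an integer power
of `b`. -/
theorem mantissa_spec {b x : ℝ} (hb : 1 < b) (hx : 0 < x) :
    mantissa b x ∈ Set.Ico 1 b ∧ ∃ k : ℤ, x = mantissa b x * b ^ k := by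
  have hb0 : 0 < b := by linarith
  have hpos : 0 < b ^ ⌊Real.logb b x⌋ := zpow_pos hb0 _
  have hx' : b ^ Real.logb b x = x := Real.rpow_logb hb0 hb.ne' hx
  refine ⟨⟨?_, ?_⟩, ⌊Real.logb b x⌋, ?_⟩
  · rw [mantissa, le_div_iff₀ hpos, one_mul, ← Real.rpow_intCast]
    calc b ^ ((⌊Real.logb b x⌋ : ℤ) : ℝ) ≤ b ^ Real.logb b x :=
          Real.rpow_le_rpow_of_exponent_le hb.le (Int.floor_le _)
      _ = x := hx'
  · rw [mantissa, div_lt_iff₀ hpos, ← zpow_one_add₀ hb0.ne', ← Real.rpow_intCast]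
    calc x = b ^ Real.logb b x := hx'.symm
      _ < b ^ (((1 + ⌊Real.logb b x⌋ : ℤ)) : ℝ) := by
          apply Real.rpow_lt_rpow_of_exponent_lt hb
          push_cast
          linarith [Int.lt_floor_add_one (Real.logb b x)]
  · rw [mantissa, div_mul_cancel₀ _ hpos.ne']

/-- It is the only such number. -/
theorem eq_mantissa {b x m : ℝ} (hb : 1 < b) (hm : m ∈ Set.Ico 1 b) (k : ℤ)
    (h : x = m * b ^ k) : m = mantissa b x := by
  have hb0 : 0 < b := by linarith
  have hm0 : 0 < m := by linarith [hm.1]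
  have hl : Real.logb b x = Real.logb b m + k := by
    rw [h, Real.logb_mul hm0.ne' (zpow_pos hb0 k).ne', ← Real.rpow_intCast,
      Real.logb_rpow hb0 hb.ne']
  have hf : ⌊Real.logb b m⌋ = 0 := by
    rw [Int.floor_eq_zero_iff]
    exact ⟨Real.logb_nonneg hb hm.1, by
      rw [Real.logb_lt_iff_lt_rpow hb hm0, Real.rpow_one]; exact hm.2⟩
  rw [mantissa, hl, Int.floor_add_intCast, hf, zero_add, h,
    mul_div_cancel_right₀ _ (zpow_pos hb0 k).ne']

/-- Benford's law `μ_b` in base `b`, as a measure on `ℝ` carried by `[1, b)`: the law of `b ^ U` with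
`U` uniform on `[0, 1)`. See `benfordLaw_Ico` for `μ_b [1, a) = log_b a`. -/
noncomputable def benfordLaw (b : ℝ) : Measure ℝ :=
  (volume.restrict (Set.Ico (0 : ℝ) 1)).map (fun t : ℝ => b ^ t)

theorem measurable_const_rpow (b : ℝ) : Measurable (fun t : ℝ => b ^ t) :=
  measurable_const.pow measurable_id

instance benfordLaw_isProbabilityMeasure (b : ℝ) : IsProbabilityMeasure (benfordLaw b) := by
  have : IsProbabilityMeasure (volume.restrict (Set.Ico (0 : ℝ) 1)) := ⟨by simp⟩
  exact Measure.isProbabilityMeasure_map (measurable_const_rpow b).aemeasurable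

/-- The defining property `μ_b [1, a) = log_b a` (for `a = b`: `μ_b` is carried by `[1, b)`). -/
theorem benfordLaw_Ico {b a : ℝ} (hb : 1 < b) (ha : 1 ≤ a) (hab : a ≤ b) :
    benfordLaw b (Set.Ico 1 a) = ENNReal.ofReal (Real.logb b a) := by
  have hb0 : 0 < b := by linarith
  have ha0 : 0 < a := by linarith
  have hl : Real.logb b a ≤ 1 := by
    rw [Real.logb_le_iff_le_rpow hb ha0, Real.rpow_one]; exact hab
  rw [benfordLaw, Measure.map_apply (measurable_const_rpow b) measurableSet_Ico,
    Measure.restrict_apply (measurable_const_rpow b measurableSet_Ico)]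
  have : (fun t : ℝ => b ^ t) ⁻¹' Set.Ico 1 a ∩ Set.Ico 0 1 = Set.Ico 0 (Real.logb b a) := by
    ext t
    simp only [Set.mem_inter_iff, Set.mem_preimage, Set.mem_Ico, Real.lt_logb_iff_rpow_lt hb ha0]
    constructor
    · rintro ⟨⟨_, h⟩, h0, _⟩
      exact ⟨h0, h⟩
    · rintro ⟨h0, h⟩
      exact ⟨⟨Real.one_le_rpow hb.le h0, h⟩, h0,
        ((Real.lt_logb_iff_rpow_lt hb ha0).2 h).trans_le hl⟩
  rw [this, Real.volume_Ico, sub_zero]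

/-- A sequence `u 1, u 2, …` of positive reals is Benford in base `b`: for every `a ∈ [1, b)`, the
proportion of the indices `n ≤ N` for which the mantissa of `u n` lies in `[1, a)` tends to
`log_b a` as `N → ∞`. -/
def IsBenfordSeq (b : ℝ) (u : ℕ → ℝ) : Prop :=
  ∀ a : ℝ, 1 ≤ a → a < b →
    Tendsto (fun N : ℕ => (1 / (N : ℝ)) *
        ∑ n ∈ Finset.Icc 1 N, (Set.Ico 1 a).indicator (fun _ => (1 : ℝ)) (mantissa b (u n)))
      atTop (𝓝 (Real.logb b a))

/-- The sequence `(Z n)` of random variables is almost surely Benford in base `b`. -/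
def IsASBenford {Ω : Type*} [MeasurableSpace Ω] (P : Measure Ω) (b : ℝ) (Z : ℕ → Ω → ℝ) : Prop :=
  ∀ᵐ ω ∂P, IsBenfordSeq b (fun n => Z n ω)

/-- `Z n` tends to be Benford in base `b`: the laws of the mantissae of the `Z n` converge weakly
to `μ_b` (the law of the identity on the probability space `(ℝ, μ_b)`). -/
def TendsToBenford {Ω : Type*} [MeasurableSpace Ω] (P : Measure Ω) [IsProbabilityMeasure P]
    (b : ℝ) (Z : ℕ → Ω → ℝ) : Prop :=
  TendstoInDistribution (fun (n : ℕ) ω => mantissa b (Z n ω)) atTop (id : ℝ → ℝ)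
    (fun _ => P) (benfordLaw b)

/-- Strict stationarity: for every `m`, the shifted sequence `(X (n + m))ₙ` has the same law, as a
random element of `ℝ^ℕ`, as the sequence `(X n)ₙ`. -/
def IsStationary {Ω : Type*} [MeasurableSpace Ω] (P : Measure Ω) (X : ℕ → Ω → ℝ) : Prop :=
  ∀ m : ℕ, IdentDistrib (fun ω (n : ℕ) => X (n + m) ω) (fun ω (n : ℕ) => X n ω) P P

/-- The product `Y n` of the first `n` terms of the sequence `X 0, X 1, …` (so the first factor is
`X 0`, and `Y 1 = X 0`). -/
def partialProd {Ω : Type*} (X : ℕ → Ω → ℝ) (n : ℕ) (ω : Ω) : ℝ :=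
  ∏ k ∈ Finset.range n, X k ω

end Benford

/-! By Weyl's criterion it is enough that, almost surely, for each integer `h ≠ 0` the averages of
`c n = e(h log_b Y_n)` tend to zero, where `e(t) = exp(2πit)`. The factor `e(h ·)` ignores integers,
so `c n` is a continuous function of the mantissa, and convergence in law to `μ_b` makes its
expectation tend to zero.

On the sequence space the law of `X` is invariant under the shift `T`, and `c` is a unimodular
cocycle: `c (k + m) = c k * (c m ∘ T^k)`. Hence the correlation of `c (k + m)` with `c k` is the
expectation of `c m`, and averages over a long block `M` are small in `L²`, so in `L¹`
(`exists_integral_norm_average_cocycle_le`).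

The step from mean to almost sure convergence rests on a domination: the average of `c` over `N`
terms is at most `2M / N` plus the Birkhoff average of the norm of the block average
(`norm_sum_cocycle_le`). The maximal ergodic inequality bounds all these Birkhoff averages at once,
outside a set of small measure. No pointwise ergodic theorem and no ergodicity are needed. -/

namespace Benford

/-! ### Cocycles and the maximal ergodic inequality -/

section Ergodic

variable {α : Type*}

/-- The running maximum `max_{0 ≤ k ≤ n} birkhoffSum T φ k`. -/
noncomputable def maxBirkhoffSum (T : α → α) (φ : α → ℝ) : ℕ → α → ℝ
  | 0, _ => 0
  | n + 1, x => max 0 (φ x + maxBirkhoffSum T φ n (T x))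

theorem maxBirkhoffSum_nonneg (T : α → α) (φ : α → ℝ) (n : ℕ) (x : α) :
    0 ≤ maxBirkhoffSum T φ n x := by
  cases n with
  | zero => exact le_rfl
  | succ n => exact le_max_left _ _

theorem maxBirkhoffSum_le_succ (T : α → α) (φ : α → ℝ) (n : ℕ) (x : α) :
    maxBirkhoffSum T φ n x ≤ maxBirkhoffSum T φ (n + 1) x := by
  induction n generalizing x with
  | zero => exact le_max_left _ _
  | succ n ih => exact max_le_max le_rfl (add_le_add le_rfl (ih (T x)))

theorem birkhoffSum_le_maxBirkhoffSum (T : α → α) (φ : α → ℝ) {k n : ℕ} (hk : k ≤ n) (x : α) :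
    birkhoffSum T φ k x ≤ maxBirkhoffSum T φ n x := by
  induction n generalizing k x with
  | zero =>
    obtain rfl : k = 0 := by omega
    simp [maxBirkhoffSum]
  | succ n ih =>
    cases k with
    | zero => simpa using maxBirkhoffSum_nonneg T φ (n + 1) x
    | succ k =>
      rw [birkhoffSum_succ']
      exact (add_le_add le_rfl (ih (by omega) (T x))).trans (le_max_right _ _)

/-- The multiplicative cocycle `∏_{k < n} f (T^k x)`. -/
noncomputable def cocycle (T : α → α) (f : α → ℂ) (n : ℕ) (x : α) : ℂ :=
  ∏ k ∈ Finset.range n, f (T^[k] x)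

/-- The averages of the first `N` values of a sequence. -/
noncomputable def average (u : ℕ → ℂ) : ℕ → ℂ :=
  fun N => (N : ℂ)⁻¹ * ∑ n ∈ Finset.range N, u n

theorem norm_average_le {u : ℕ → ℂ} {C : ℝ} (hC : 0 ≤ C) (hu : ∀ n, ‖u n‖ ≤ C) (N : ℕ) :
    ‖average u N‖ ≤ C := by
  rcases Nat.eq_zero_or_pos N with rfl | hN
  · simpa [average] using hC
  · have hNr : (0 : ℝ) < N := by exact_mod_cast hN
    rw [average, norm_mul, norm_inv, Complex.norm_natCast, inv_mul_le_iff₀ hNr]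
    simpa using norm_sum_le_of_le (Finset.range N) (fun k _ => hu k)

variable {T : α → α} {f : α → ℂ}

theorem cocycle_add (k n : ℕ) (x : α) :
    cocycle T f (k + n) x = cocycle T f k x * cocycle T f n (T^[k] x) := by
  simp only [cocycle, Finset.prod_range_add, ← Function.iterate_add_apply, add_comm]

theorem norm_cocycle (hf : ∀ x, ‖f x‖ = 1) (n : ℕ) (x : α) : ‖cocycle T f n x‖ = 1 := by
  simp [cocycle, hf]

theorem norm_sum_range_shift_sub_le {u : ℕ → ℂ} (hu : ∀ n, ‖u n‖ ≤ 1) (N n : ℕ) :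
    ‖∑ k ∈ Finset.range N, u (k + n) - ∑ k ∈ Finset.range N, u k‖ ≤ 2 * n := by
  have h1 := Finset.sum_range_add u n N
  have h2 := Finset.sum_range_add u N n
  have h3 : ∑ k ∈ Finset.range N, u (k + n) - ∑ k ∈ Finset.range N, u k
      = ∑ k ∈ Finset.range n, u (N + k) - ∑ k ∈ Finset.range n, u k := by
    rw [add_comm N n, h1] at h2
    simp only [add_comm _ n]
    linear_combination h2
  rw [h3]
  have h4 : ‖∑ k ∈ Finset.range n, u (N + k)‖ ≤ n := by
    simpa using norm_sum_le_of_le (Finset.range n) (fun k _ => hu (N + k))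
  have h5 : ‖∑ k ∈ Finset.range n, u k‖ ≤ n := by
    simpa using norm_sum_le_of_le (Finset.range n) (fun k _ => hu k)
  linarith [norm_sub_le (∑ k ∈ Finset.range n, u (N + k)) (∑ k ∈ Finset.range n, u k)]

/-- Shifting the sum by `n < M` costs at most `2n ≤ 2M`. Averaged over these shifts, the `k`-th term
becomes `u k` times the block average started at `T^k x`, and `u k` has norm one, so only the norm
of the block average remains. -/
theorem norm_sum_cocycle_le (hf : ∀ x, ‖f x‖ = 1) {M : ℕ} (hM : 0 < M) (N : ℕ) (x : α) :
    ‖∑ k ∈ Finset.range N, cocycle T f k x‖ ≤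
      2 * M + birkhoffSum T (fun y => ‖average (fun n => cocycle T f n y) M‖) N x := by
  set u : ℕ → ℂ := fun k => cocycle T f k x
  have hu : ∀ n, ‖u n‖ ≤ 1 := fun n => (norm_cocycle hf n x).le
  have hM' : (M : ℂ) ≠ 0 := by exact_mod_cast hM.ne'
  have hMr : (0 : ℝ) < M := by exact_mod_cast hM
  have key : ∑ k ∈ Finset.range N, u k * average (fun n => cocycle T f n (T^[k] x)) M
      = (M : ℂ)⁻¹ * ∑ n ∈ Finset.range M, ∑ k ∈ Finset.range N, u (k + n) := by
    rw [Finset.sum_comm, Finset.mul_sum]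
    refine Finset.sum_congr rfl fun k _ => ?_
    simp only [average, u, cocycle_add, Finset.mul_sum]
    exact Finset.sum_congr rfl fun n _ => by ring
  have h1 : ∑ k ∈ Finset.range N, u k =
      ∑ k ∈ Finset.range N, u k * average (fun n => cocycle T f n (T^[k] x)) M
      - (M : ℂ)⁻¹ * ∑ n ∈ Finset.range M,
        (∑ k ∈ Finset.range N, u (k + n) - ∑ k ∈ Finset.range N, u k) := by
    rw [key, Finset.sum_sub_distrib]
    simp only [Finset.sum_const, Finset.card_range, nsmul_eq_mul]
    field_simp
    ring
  have h2 : ‖(M : ℂ)⁻¹ * ∑ n ∈ Finset.range M,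
        (∑ k ∈ Finset.range N, u (k + n) - ∑ k ∈ Finset.range N, u k)‖ ≤ 2 * M := by
    have : ‖∑ n ∈ Finset.range M,
        (∑ k ∈ Finset.range N, u (k + n) - ∑ k ∈ Finset.range N, u k)‖ ≤ M * (2 * M) := by
      have := norm_sum_le_of_le (Finset.range M)
        (f := fun n => ∑ k ∈ Finset.range N, u (k + n) - ∑ k ∈ Finset.range N, u k)
        (n := fun _ => 2 * (M : ℝ)) fun n hn => (norm_sum_range_shift_sub_le hu N n).trans (by
          have : (n : ℝ) ≤ M := by exact_mod_cast (Finset.mem_range.1 hn).le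
          linarith)
      simpa using this
    rw [norm_mul, norm_inv, Complex.norm_natCast, inv_mul_le_iff₀ hMr]
    exact this
  have h3 : ‖∑ k ∈ Finset.range N, u k * average (fun n => cocycle T f n (T^[k] x)) M‖
      ≤ birkhoffSum T (fun y => ‖average (fun n => cocycle T f n y) M‖) N x := by
    refine norm_sum_le_of_le _ fun k _ => ?_
    rw [norm_mul, norm_cocycle hf, one_mul]
  rw [h1]
  linarith [norm_sub_le (∑ k ∈ Finset.range N, u k * average (fun n => cocycle T f n (T^[k] x)) M)
    ((M : ℂ)⁻¹ * ∑ n ∈ Finset.range M,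
        (∑ k ∈ Finset.range N, u (k + n) - ∑ k ∈ Finset.range N, u k))]

variable [MeasurableSpace α] {μ : Measure α}

theorem measurable_maxBirkhoffSum (hT : Measurable T) {φ : α → ℝ} (hφ : Measurable φ) (n : ℕ) :
    Measurable (maxBirkhoffSum T φ n) := by
  induction n with
  | zero => exact measurable_const
  | succ n ih => exact measurable_const.max (hφ.add (ih.comp hT))

theorem integrable_maxBirkhoffSum (hT : MeasurePreserving T μ μ) {φ : α → ℝ}
    (hφ : Integrable φ μ) (n : ℕ) : Integrable (maxBirkhoffSum T φ n) μ := by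
  induction n with
  | zero => exact integrable_zero _ _ _
  | succ n ih => exact (integrable_zero _ _ _).sup (hφ.add (hT.integrable_comp_of_integrable ih))

/-- The maximal ergodic theorem, for finitely many Birkhoff sums. -/
theorem setIntegral_maxBirkhoffSum_pos_nonneg (hT : MeasurePreserving T μ μ) {φ : α → ℝ}
    (hφm : Measurable φ) (hφ : Integrable φ μ) (n : ℕ) :
    0 ≤ ∫ x in {x | 0 < maxBirkhoffSum T φ n x}, φ x ∂μ := by
  cases n with
  | zero => simp [maxBirkhoffSum]
  | succ n =>
    have hM := integrable_maxBirkhoffSum hT hφ (n + 1)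
    have hset : MeasurableSet {x | 0 < maxBirkhoffSum T φ (n + 1) x} :=
      measurableSet_lt measurable_const (measurable_maxBirkhoffSum hT.measurable hφm _)
    have hcomp : ∫ x, maxBirkhoffSum T φ (n + 1) (T x) ∂μ
        = ∫ x, maxBirkhoffSum T φ (n + 1) x ∂μ := by
      conv_rhs => rw [← hT.map_eq]
      rw [integral_map hT.measurable.aemeasurable]
      exact (measurable_maxBirkhoffSum hT.measurable hφm _).aestronglyMeasurable
    have hMT : Integrable (fun x => maxBirkhoffSum T φ (n + 1) (T x)) μ :=
      hT.integrable_comp_of_integrable hM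
    rw [← integral_indicator hset]
    -- Let `m` be the running maximum. Since `m` and `m ∘ T` have equal integrals, it suffices that
    -- `m - m ∘ T` is at most `φ` where `m > 0`, by the recursion, and at most `0` elsewhere, where
    -- `m = 0 ≤ m ∘ T`.
    calc (0 : ℝ) = ∫ x, (maxBirkhoffSum T φ (n + 1) x - maxBirkhoffSum T φ (n + 1) (T x)) ∂μ := by
          rw [integral_sub hM hMT, hcomp, sub_self]
      _ ≤ _ := by
          refine integral_mono (hM.sub hMT) (hφ.indicator hset) fun x => ?_
          by_cases hx : 0 < maxBirkhoffSum T φ (n + 1) x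
          · rw [Set.indicator_of_mem (show x ∈ {x | 0 < maxBirkhoffSum T φ (n + 1) x} from hx)]
            have h1 : maxBirkhoffSum T φ (n + 1) x = φ x + maxBirkhoffSum T φ n (T x) := by
              have := (lt_max_iff.1 hx).resolve_left (lt_irrefl _)
              exact max_eq_right this.le
            have h2 := maxBirkhoffSum_le_succ T φ n (T x)
            linarith
          · rw [Set.indicator_of_notMem (show x ∉ {x | 0 < maxBirkhoffSum T φ (n + 1) x} from hx)]
            have h2 := maxBirkhoffSum_nonneg T φ (n + 1) (T x)
            linarith

/-- The maximal ergodic inequality. -/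
theorem measure_exists_lt_birkhoffSum_le [IsFiniteMeasure μ] (hT : MeasurePreserving T μ μ)
    {g : α → ℝ} (hgm : Measurable g) (hg : Integrable g μ) (hg0 : ∀ x, 0 ≤ g x) {l : ℝ}
    (hl : 0 < l) :
    μ {x | ∃ n : ℕ, n * l < birkhoffSum T g n x} ≤ ENNReal.ofReal ((∫ x, g x ∂μ) / l) := by
  -- Subtracting `l` turns "some Birkhoff average of `g` exceeds `l`" into "some Birkhoff sum of `φ`
  -- is positive".
  set φ : α → ℝ := fun x => g x - l with hφdef
  have hφm : Measurable φ := hgm.sub measurable_const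
  have hφ : Integrable φ μ := hg.sub (integrable_const l)
  have hsum : ∀ n x, birkhoffSum T φ n x = birkhoffSum T g n x - n * l := by
    intro n x
    simp [birkhoffSum, hφdef, Finset.sum_sub_distrib]
  set E : ℕ → Set α := fun n => {x | 0 < maxBirkhoffSum T φ n x} with hE
  have hEm : ∀ n, MeasurableSet (E n) := fun n =>
    measurableSet_lt measurable_const (measurable_maxBirkhoffSum hT.measurable hφm _)
  have hmono : Monotone E := monotone_nat_of_le_succ fun n x hx =>
    lt_of_lt_of_le (show 0 < maxBirkhoffSum T φ n x from hx) (maxBirkhoffSum_le_succ T φ n x)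
  have hsub : {x | ∃ n : ℕ, n * l < birkhoffSum T g n x} ⊆ ⋃ n, E n := by
    rintro x ⟨n, hn⟩
    refine Set.mem_iUnion.2 ⟨n, ?_⟩
    have := birkhoffSum_le_maxBirkhoffSum T φ (le_refl n) x
    rw [hsum] at this
    show 0 < maxBirkhoffSum T φ n x
    linarith
  refine (measure_mono hsub).trans ?_
  rw [hmono.measure_iUnion]
  refine iSup_le fun n => ?_
  have h0 := setIntegral_maxBirkhoffSum_pos_nonneg hT hφm hφ n
  have h1 : ∫ x in E n, φ x ∂μ = (∫ x in E n, g x ∂μ) - μ.real (E n) * l := by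
    rw [integral_sub hg.integrableOn (integrable_const l).integrableOn]
    simp
  have h2 : ∫ x in E n, g x ∂μ ≤ ∫ x, g x ∂μ :=
    setIntegral_le_integral hg (ae_of_all _ hg0)
  have h3 : μ.real (E n) ≤ (∫ x, g x ∂μ) / l := by
    rw [le_div_iff₀ hl]
    have : 0 ≤ ∫ x in E n, φ x ∂μ := h0
    linarith
  rw [← ofReal_measureReal]
  exact ENNReal.ofReal_le_ofReal h3

theorem measurable_cocycle (hT : Measurable T) (hf : Measurable f) (n : ℕ) :
    Measurable (cocycle T f n) :=
  Finset.measurable_fun_prod _ fun k _ => hf.comp (hT.iterate k)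

end Ergodic

/-! ### Almost everywhere convergence of cocycle averages -/

section Ergodic

variable {α : Type*} [MeasurableSpace α] {μ : Measure α} {T : α → α} {f : α → ℂ}

theorem measurable_average_cocycle (hT : Measurable T) (hf : Measurable f) (N : ℕ) :
    Measurable (fun x => average (fun n => cocycle T f n x) N) :=
  measurable_const.mul (Finset.measurable_fun_sum _ fun n _ => measurable_cocycle hT hf n)

theorem integrable_of_measurable_of_norm_le [IsFiniteMeasure μ] {E : Type*} [NormedAddCommGroup E]
    [MeasurableSpace E] [BorelSpace E] [SecondCountableTopology E] {g : α → E}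
    (hg : Measurable g) (C : ℝ) (hC : ∀ x, ‖g x‖ ≤ C) : Integrable g μ :=
  Integrable.of_bound hg.aestronglyMeasurable C (ae_of_all _ hC)

/-- The first `k` factors cancel against their conjugates, leaving `cocycle T f m ∘ T^k`, and `T^k`
preserves `μ`. -/
theorem integral_cocycle_mul_conj (hT : MeasurePreserving T μ μ) (hf : Measurable f)
    (hf1 : ∀ x, ‖f x‖ = 1) (k m : ℕ) :
    ∫ x, cocycle T f (k + m) x * starRingEnd ℂ (cocycle T f k x) ∂μ = ∫ x, cocycle T f m x ∂μ := by
  have h : ∀ x, cocycle T f (k + m) x * starRingEnd ℂ (cocycle T f k x)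
      = cocycle T f m (T^[k] x) := by
    intro x
    have h1 : cocycle T f k x * starRingEnd ℂ (cocycle T f k x) = 1 := by
      rw [Complex.mul_conj, Complex.normSq_eq_norm_sq, norm_cocycle hf1]; simp
    rw [cocycle_add, mul_right_comm, h1, one_mul]
  simp only [h]
  conv_rhs => rw [← (hT.iterate k).map_eq]
  rw [integral_map (hT.iterate k).measurable.aemeasurable]
  exact (measurable_cocycle hT.measurable hf m).aestronglyMeasurable

/-- Expanding the square as `M` grows by one adds a diagonal term `1` and twice the real part of the
correlations of the new term with the old ones, which depend only on the lag. -/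
theorem integral_norm_sum_cocycle_sq_le [IsProbabilityMeasure μ] (hT : MeasurePreserving T μ μ)
    (hf : Measurable f) (hf1 : ∀ x, ‖f x‖ = 1) (M : ℕ) :
    ∫ x, ‖∑ k ∈ Finset.range M, cocycle T f k x‖ ^ 2 ∂μ ≤
      2 * M * ∑ j ∈ Finset.range M, ‖∫ x, cocycle T f j x ∂μ‖ := by
  induction M with
  | zero => simp
  | succ M ih =>
    set a : ℕ → ℝ := fun j => ‖∫ x, cocycle T f j x ∂μ‖ with ha
    have hc := fun n => measurable_cocycle (f := f) hT.measurable hf n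
    have hP : Measurable (fun x => ∑ k ∈ Finset.range M, cocycle T f k x) :=
      Finset.measurable_fun_sum _ fun n _ => hc n
    have hpt : ∀ x, ‖∑ k ∈ Finset.range (M + 1), cocycle T f k x‖ ^ 2 =
        ‖∑ k ∈ Finset.range M, cocycle T f k x‖ ^ 2 + 1 +
        2 * (∑ k ∈ Finset.range M,
          cocycle T f M x * starRingEnd ℂ (cocycle T f k x)).re := by
      intro x
      rw [Finset.sum_range_succ, add_comm (∑ k ∈ Finset.range M, _), ← Complex.normSq_eq_norm_sq,
        Complex.normSq_add, Complex.normSq_eq_norm_sq, norm_cocycle hf1, map_sum (starRingEnd ℂ),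
        Finset.mul_sum, Complex.normSq_eq_norm_sq]
      ring
    have hi1 : Integrable (fun x => ‖∑ k ∈ Finset.range M, cocycle T f k x‖ ^ 2) μ := by
      refine integrable_of_measurable_of_norm_le (hP.norm.pow_const 2) ((M : ℝ) ^ 2) fun x => ?_
      rw [Real.norm_of_nonneg (by positivity)]
      gcongr
      simpa using norm_sum_le_of_le (Finset.range M) (fun k _ => (norm_cocycle hf1 (T := T) k x).le)
    have hi2 : ∀ k, Integrable
        (fun x => cocycle T f M x * starRingEnd ℂ (cocycle T f k x)) μ := by
      intro k
      refine integrable_of_measurable_of_norm_le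
        ((hc M).mul (Complex.continuous_conj.measurable.comp (hc k))) 1 fun x => ?_
      rw [norm_mul, RCLike.norm_conj, norm_cocycle hf1, norm_cocycle hf1, one_mul]
    have hi3 : Integrable (fun x => ∑ k ∈ Finset.range M,
        cocycle T f M x * starRingEnd ℂ (cocycle T f k x)) μ :=
      integrable_finsetSum _ fun k _ => hi2 k
    have hre : ∫ x, (∑ k ∈ Finset.range M,
        cocycle T f M x * starRingEnd ℂ (cocycle T f k x)).re ∂μ
        ≤ ∑ j ∈ Finset.range M, a (j + 1) := by
      calc ∫ x, (∑ k ∈ Finset.range M,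
            cocycle T f M x * starRingEnd ℂ (cocycle T f k x)).re ∂μ
          = (∫ x, ∑ k ∈ Finset.range M,
            cocycle T f M x * starRingEnd ℂ (cocycle T f k x) ∂μ).re := integral_re hi3
        _ ≤ ‖∫ x, ∑ k ∈ Finset.range M,
            cocycle T f M x * starRingEnd ℂ (cocycle T f k x) ∂μ‖ := Complex.re_le_norm _
        _ ≤ ∑ k ∈ Finset.range M, a (M - k) := by
            rw [integral_finsetSum _ fun k _ => hi2 k]
            refine norm_sum_le_of_le _ fun k hk => ?_
            have hk' : k + (M - k) = M := by have := Finset.mem_range.1 hk; omega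
            have := integral_cocycle_mul_conj hT hf hf1 k (M - k)
            rw [hk'] at this
            rw [this]
        _ = ∑ j ∈ Finset.range M, a (j + 1) := by
            rw [← Finset.sum_range_reflect]
            refine Finset.sum_congr rfl fun j hj => ?_
            have := Finset.mem_range.1 hj
            congr 1; omega
    -- The lag-zero term pays for the diagonal: `1 + 2 (a 1 + … + a M) ≤ 2 (a 0 + … + a M)`.
    have ha0 : a 0 = 1 := by simp [ha, cocycle]
    have hB := Finset.sum_range_succ' a M
    have hB' := Finset.sum_range_succ a M
    have haM : 0 ≤ a M := norm_nonneg _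
    simp only [hpt]
    have hi4 : Integrable (fun x => 2 * (∑ k ∈ Finset.range M,
        cocycle T f M x * starRingEnd ℂ (cocycle T f k x)).re) μ := hi3.re.const_mul 2
    have hi5 : Integrable (fun x => ‖∑ k ∈ Finset.range M, cocycle T f k x‖ ^ 2 + 1) μ :=
      hi1.add (integrable_const _)
    rw [integral_add hi5 hi4, integral_add hi1 (integrable_const _), integral_const_mul]
    simp only [integral_const, probReal_univ, one_smul]
    have hMnn : (0 : ℝ) ≤ M := M.cast_nonneg
    have : 2 * (M : ℝ) * ∑ j ∈ Finset.range M, a j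
        ≤ 2 * M * ∑ j ∈ Finset.range (M + 1), a j := by
      gcongr
      linarith
    push_cast
    linarith

theorem exists_integral_norm_average_cocycle_le [IsProbabilityMeasure μ]
    (hT : MeasurePreserving T μ μ) (hf : Measurable f) (hf1 : ∀ x, ‖f x‖ = 1)
    (hlim : Tendsto (fun n => ∫ x, cocycle T f n x ∂μ) atTop (𝓝 0)) {δ : ℝ} (hδ : 0 < δ) :
    ∃ M : ℕ, 0 < M ∧ ∫ x, ‖average (fun n => cocycle T f n x) M‖ ∂μ ≤ δ := by
  have hces := (hlim.norm.cesaro)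
  rw [norm_zero] at hces
  obtain ⟨M, hMpos, hM⟩ := ((eventually_gt_atTop 0).and
    (hces.eventually (gt_mem_nhds (show (0 : ℝ) < δ ^ 2 / 8 by positivity)))).exists
  refine ⟨M, hMpos, ?_⟩
  have hMr : (0 : ℝ) < M := by exact_mod_cast hMpos
  set S : α → ℂ := fun x => average (fun n => cocycle T f n x) M with hS
  have hSm : Measurable S := measurable_average_cocycle hT.measurable hf M
  have hSsq : ∀ x, ‖S x‖ = (M : ℝ)⁻¹ * ‖∑ k ∈ Finset.range M, cocycle T f k x‖ := by
    intro x
    simp [hS, average]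
  have hS1 : ∀ x, ‖S x‖ ≤ 1 := fun x =>
    norm_average_le zero_le_one (fun n => (norm_cocycle hf1 n x).le) M
  have hi : Integrable (fun x => ‖S x‖) μ :=
    integrable_of_measurable_of_norm_le hSm.norm 1 (by simpa using hS1)
  have hi2 : Integrable (fun x => ‖S x‖ ^ 2) μ := by
    refine integrable_of_measurable_of_norm_le (hSm.norm.pow_const 2) 1 fun x => ?_
    rw [Real.norm_of_nonneg (by positivity)]
    exact pow_le_one₀ (norm_nonneg _) (hS1 x)
  have hsq : ∫ x, ‖S x‖ ^ 2 ∂μ ≤ δ ^ 2 / 4 := by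
    have h1 := integral_norm_sum_cocycle_sq_le hT hf hf1 M
    simp only [hSsq, mul_pow, integral_const_mul]
    calc (M : ℝ)⁻¹ ^ 2 * ∫ x, ‖∑ k ∈ Finset.range M, cocycle T f k x‖ ^ 2 ∂μ
        ≤ (M : ℝ)⁻¹ ^ 2 * (2 * M * ∑ j ∈ Finset.range M, ‖∫ x, cocycle T f j x ∂μ‖) := by
          gcongr
      _ = 2 * ((M : ℝ)⁻¹ * ∑ j ∈ Finset.range M, ‖∫ x, cocycle T f j x ∂μ‖) := by
          field_simp
      _ ≤ δ ^ 2 / 4 := by linarith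
  -- The elementary inequality `s ≤ δ / 4 + s² / δ` replaces Cauchy–Schwarz in passing from `L²` to
  -- `L¹`.
  calc ∫ x, ‖S x‖ ∂μ ≤ ∫ x, (δ / 4 + δ⁻¹ * ‖S x‖ ^ 2) ∂μ := by
        refine integral_mono hi ((integrable_const _).add (hi2.const_mul _)) fun x => ?_
        have : 0 ≤ δ⁻¹ * (‖S x‖ - δ / 2) ^ 2 := by positivity
        have e : δ⁻¹ * (‖S x‖ - δ / 2) ^ 2 = δ⁻¹ * ‖S x‖ ^ 2 - ‖S x‖ + δ / 4 := by
          field_simp; ring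
        show ‖S x‖ ≤ δ / 4 + δ⁻¹ * ‖S x‖ ^ 2
        linarith
    _ = δ / 4 + δ⁻¹ * ∫ x, ‖S x‖ ^ 2 ∂μ := by
        rw [integral_add (integrable_const _) (hi2.const_mul _), integral_const_mul]
        simp
    _ ≤ δ / 4 + δ⁻¹ * (δ ^ 2 / 4) := by gcongr
    _ ≤ δ := by
        have : δ⁻¹ * (δ ^ 2 / 4) = δ / 4 := by field_simp
        linarith

/-- If the integrals of the cocycle generated by a unimodular function over a measure preserving
map tend to zero, then the averages of the cocycle tend to zero almost everywhere. -/
theorem ae_tendsto_average_cocycle [IsProbabilityMeasure μ]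
    (hT : MeasurePreserving T μ μ) (hf : Measurable f) (hf1 : ∀ x, ‖f x‖ = 1)
    (hlim : Tendsto (fun n => ∫ x, cocycle T f n x ∂μ) atTop (𝓝 0)) :
    ∀ᵐ x ∂μ, Tendsto (average fun n => cocycle T f n x) atTop (𝓝 0) := by
  have key : ∀ j : ℕ, ∀ᵐ x ∂μ, ∀ᶠ N in atTop,
      ‖average (fun n => cocycle T f n x) N‖ ≤ 2 * ((j : ℝ) + 1)⁻¹ := by
    intro j
    set l : ℝ := ((j : ℝ) + 1)⁻¹ with hl
    have hl0 : 0 < l := by positivity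
    rw [ae_iff]
    refine le_antisymm (ENNReal.le_of_forall_pos_le_add fun ε hε _ => ?_) zero_le
    -- The tolerance `ε * l` absorbs the division by `l` in the maximal inequality, so the
    -- exceptional set has measure at most `ε`.
    obtain ⟨M, hM, hMle⟩ := exists_integral_norm_average_cocycle_le hT hf hf1 hlim
      (show (0 : ℝ) < ε * l by positivity)
    set g : α → ℝ := fun y => ‖average (fun n => cocycle T f n y) M‖
    have hgm : Measurable g := (measurable_average_cocycle hT.measurable hf M).norm
    have hg1 : ∀ x, ‖g x‖ ≤ 1 := fun x => by
      simpa [g] using norm_average_le zero_le_one (fun n => (norm_cocycle hf1 (T := T) n x).le) M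
    have hmax := measure_exists_lt_birkhoffSum_le hT hgm
      (integrable_of_measurable_of_norm_le hgm 1 hg1) (fun x => norm_nonneg _) hl0
    refine (measure_mono fun x hx => ?_).trans (hmax.trans ?_)
    · by_contra hcon
      refine hx ?_
      simp only [Set.mem_ofPred_eq, not_exists, not_lt] at hcon
      -- Beyond `N₀` the boundary term `2M / N` is below `l`; the Birkhoff average contributes
      -- another `l`, whence the bound `2l`.
      obtain ⟨N₀, hN₀⟩ := exists_nat_gt (2 * M / l)
      filter_upwards [eventually_ge_atTop N₀, eventually_gt_atTop 0] with N hN hNpos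
      have hNr : (0 : ℝ) < N := by exact_mod_cast hNpos
      have h1 := norm_sum_cocycle_le hf1 hM N x (T := T)
      have h2 := hcon N
      have h3 : 2 * M < N * l := by
        rw [← div_lt_iff₀ hl0]
        exact hN₀.trans_le (by exact_mod_cast hN)
      simp only [average, norm_mul, norm_inv, Complex.norm_natCast]
      rw [inv_mul_le_iff₀ hNr]
      linarith
    · rw [zero_add, ← ENNReal.ofReal_coe_nnreal]
      refine ENNReal.ofReal_le_ofReal ?_
      rwa [div_le_iff₀ hl0]
  filter_upwards [ae_all_iff.2 key] with x hx
  rw [Metric.tendsto_atTop']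
  intro ε hε
  obtain ⟨j, hj⟩ := exists_nat_one_div_lt (show 0 < ε / 2 by positivity)
  obtain ⟨N, hN⟩ := eventually_atTop.1 (hx j)
  refine ⟨N, fun n hn => ?_⟩
  rw [dist_zero_right]
  have := hN n hn.le
  rw [one_div] at hj
  linarith

end Ergodic

/-! ### Weyl's criterion on the circle -/

section Weyl

/-- The uniform measure on the first `N + 1` terms of a sequence. -/
noncomputable def empiricalMeasure {E : Type*} [MeasurableSpace E] (t : ℕ → E) (N : ℕ) :
    Measure E :=
  (((N + 1 : ℕ) : ENNReal))⁻¹ • ∑ n ∈ Finset.range (N + 1), Measure.dirac (t n)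

instance {E : Type*} [MeasurableSpace E] (t : ℕ → E) (N : ℕ) :
    IsProbabilityMeasure (empiricalMeasure t N) := by
  refine ⟨?_⟩
  simp only [empiricalMeasure, Measure.smul_apply, Measure.finsetSum_apply, measure_univ,
    Finset.sum_const, Finset.card_range, smul_eq_mul, nsmul_eq_mul, mul_one]
  exact ENNReal.inv_mul_cancel (by simp) (by simp)

theorem integral_empiricalMeasure {E : Type*} [MeasurableSpace E] (t : ℕ → E) (N : ℕ)
    {φ : E → ℂ} (hφ : StronglyMeasurable φ) :
    ∫ x, φ x ∂empiricalMeasure t N = average (fun n => φ (t n)) (N + 1) := by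
  have hi : ∀ n, Integrable φ (Measure.dirac (t n)) := fun n =>
    integrable_dirac' hφ enorm_lt_top
  rw [empiricalMeasure, integral_smul_measure, integral_finsetSum_measure fun n _ => hi n]
  simp only [integral_dirac' φ _ hφ, average]
  rw [ENNReal.toReal_inv, ENNReal.toReal_natCast, Complex.real_smul]
  push_cast
  rfl

instance : IsProbabilityMeasure (volume : Measure UnitAddCircle) :=
  ⟨UnitAddCircle.measure_univ⟩

/-- Weyl's criterion, for continuous functions. -/
theorem tendsto_average_of_fourier {t : ℕ → UnitAddCircle}
    (ht : ∀ h : ℤ, h ≠ 0 → Tendsto (average fun n => fourier h (t n)) atTop (𝓝 0))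
    (φ : C(UnitAddCircle, ℂ)) :
    Tendsto (average fun n => φ (t n)) atTop (𝓝 (∫ x, φ x)) := by
  have hint : ∀ ψ : C(UnitAddCircle, ℂ), Integrable (fun x => ψ x) volume := fun ψ =>
    ψ.continuous.integrable_of_hasCompactSupport (HasCompactSupport.of_compactSpace _)
  have hspan : ∀ ψ ∈ Submodule.span ℂ (Set.range (@fourier (1 : ℝ))),
      Tendsto (average fun n => ψ (t n)) atTop (𝓝 (∫ x, ψ x)) := by
    intro ψ hψ
    induction hψ using Submodule.span_induction with
    | mem ψ hψ =>
      obtain ⟨h, rfl⟩ := hψ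
      by_cases hh : h = 0
      · subst hh
        refine (tendsto_const_nhds (x := (1 : ℂ))).congr' ?_ |>.trans ?_
        -- The empty average is `0`, so the constant `1` is recovered only for `N > 0`.
        · filter_upwards [eventually_gt_atTop 0] with N hN
          have : (N : ℂ) ≠ 0 := by exact_mod_cast hN.ne'
          simp [average, this]
        · simp
      · convert ht h hh
        -- Translation by half a period of the character changes its sign, so its integral equals
        -- its own negative.
        have := fourier_add_half_inv_index (T := 1) hh one_pos
        exact integral_eq_zero_of_add_right_eq_neg this
    | zero =>
      have h0 : (average fun _ => (0 : ℂ)) = fun _ => 0 := by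
        funext N
        simp [average]
      simp [h0]
    | add ψ χ _ _ h1 h2 =>
      have := h1.add h2
      rw [← integral_add (hint ψ) (hint χ)] at this
      refine this.congr fun N => ?_
      simp [average, Finset.sum_add_distrib, mul_add]
    | smul c ψ _ h1 =>
      have := h1.const_mul c
      rw [← integral_const_mul] at this
      refine this.congr fun N => ?_
      simp only [average, ContinuousMap.smul_apply, smul_eq_mul, ← Finset.mul_sum]
      ring
  rw [Metric.tendsto_atTop]
  intro ε hε
  -- Trigonometric polynomials are uniformly dense, and both averaging and integration are
  -- contractions for the sup norm.
  have hφ : φ ∈ closure ((Submodule.span ℂ (Set.range (@fourier (1 : ℝ))) :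
      Submodule ℂ C(UnitAddCircle, ℂ)) : Set C(UnitAddCircle, ℂ)) := by
    rw [← Submodule.topologicalClosure_coe, span_fourier_closure_eq_top]
    trivial
  obtain ⟨ψ, hψ, hd⟩ := Metric.mem_closure_iff.1 hφ (ε / 4) (by positivity)
  obtain ⟨N₀, hN₀⟩ := Metric.tendsto_atTop.1 (hspan ψ hψ) (ε / 4) (by positivity)
  have hpt : ∀ x, ‖φ x - ψ x‖ ≤ ε / 4 := fun x => by
    rw [← dist_eq_norm]
    exact (ContinuousMap.dist_apply_le_dist x).trans hd.le
  refine ⟨N₀, fun N hN => ?_⟩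
  have h1 : dist (average (fun n => φ (t n)) N) (average (fun n => ψ (t n)) N) ≤ ε / 4 := by
    have := norm_average_le (by positivity) (fun n => hpt (t n)) N
    have e : average (fun n => φ (t n)) N - average (fun n => ψ (t n)) N =
        average (fun n => φ (t n) - ψ (t n)) N := by
      simp [average, Finset.sum_sub_distrib, mul_sub]
    rwa [dist_eq_norm, e]
  have h2 : dist (∫ x, ψ x) (∫ x, φ x) ≤ ε / 4 := by
    rw [dist_comm, dist_eq_norm, ← integral_sub (hint φ) (hint ψ)]
    simpa using norm_integral_le_of_norm_le_const (μ := (volume : Measure UnitAddCircle))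
      (ae_of_all _ hpt)
  have h3 := hN₀ N hN
  have h4 := dist_triangle4 (average (fun n => φ (t n)) N) (average (fun n => ψ (t n)) N)
    (∫ x, ψ x) (∫ x, φ x)
  linarith

/-- The image of `Icc` is compact, hence closed, and the image of `Ioo` is open because the quotient
map is open; only the endpoints lie between them. This makes the arc a continuity set for the
portmanteau theorem. -/
theorem frontier_image_coe_Ico_subset (a : ℝ) :
    frontier (((↑) : ℝ → UnitAddCircle) '' Set.Ico 0 a) ⊆ {((0 : ℝ) : UnitAddCircle), ↑a} := by
  rintro x ⟨hxc, hxi⟩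
  have hc : closure (((↑) : ℝ → UnitAddCircle) '' Set.Ico 0 a) ⊆ (↑) '' Set.Icc 0 a :=
    closure_minimal (Set.image_mono Set.Ico_subset_Icc_self)
      (isCompact_Icc.image (AddCircle.continuous_mk' 1)).isClosed
  have ho : ((↑) : ℝ → UnitAddCircle) '' Set.Ioo 0 a ⊆
      interior (((↑) : ℝ → UnitAddCircle) '' Set.Ico 0 a) :=
    interior_maximal (Set.image_mono Set.Ioo_subset_Ico_self)
      (QuotientAddGroup.isOpenMap_coe _ isOpen_Ioo)
  obtain ⟨y, hy, rfl⟩ := hc hxc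
  have hy' : y ∉ Set.Ioo 0 a := fun h => hxi (ho ⟨y, h, rfl⟩)
  rcases eq_or_lt_of_le hy.1 with h | h
  · left; rw [← h]
  · rcases eq_or_lt_of_le hy.2 with h2 | h2
    · right; rw [h2]; rfl
    · exact absurd ⟨h, h2⟩ hy'

theorem coe_mem_image_coe_Ico_iff {a : ℝ} (ha : a ≤ 1) (x : ℝ) :
    (x : UnitAddCircle) ∈ ((↑) : ℝ → UnitAddCircle) '' Set.Ico 0 a ↔ Int.fract x < a := by
  constructor
  · rintro ⟨y, hy, hxy⟩
    rw [← AddCircle.coe_fract x] at hxy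
    have h2 := (AddCircle.coe_eq_coe_iff_of_mem_Ico (p := (1 : ℝ)) (a := 0)
      ⟨hy.1, by simpa using hy.2.trans_le ha⟩
      ⟨Int.fract_nonneg x, by simpa using Int.fract_lt_one x⟩).1 hxy
    rw [← h2]
    exact hy.2
  · exact fun h => ⟨Int.fract x, ⟨Int.fract_nonneg x, h⟩, AddCircle.coe_fract x⟩

theorem measurableSet_image_coe_Ico (a : ℝ) :
    MeasurableSet (((↑) : ℝ → UnitAddCircle) '' Set.Ico 0 a) := by
  rcases le_or_gt a 0 with ha | ha
  · simp [Set.Ico_eq_empty_of_le ha]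
  · rw [← Set.Ioo_insert_left ha, Set.image_insert_eq]
    exact (QuotientAddGroup.isOpenMap_coe _ isOpen_Ioo).measurableSet.insert _

theorem volume_image_coe_Ico {a : ℝ} (ha : a ≤ 1) :
    volume (((↑) : ℝ → UnitAddCircle) '' Set.Ico 0 a) = ENNReal.ofReal a := by
  have hm := measurableSet_image_coe_Ico a
  rw [← (UnitAddCircle.measurePreserving_mk 0).measure_preimage hm.nullMeasurableSet,
    zero_add, ← restrict_Ico_eq_restrict_Ioc,
    Measure.restrict_apply (AddCircle.measurable_mk' hm)]
  have : ((↑) : ℝ → UnitAddCircle) ⁻¹' (((↑) : ℝ → UnitAddCircle) '' Set.Ico 0 a) ∩ Set.Ico 0 1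
      = Set.Ico 0 a := by
    ext x
    rw [Set.mem_inter_iff, Set.mem_preimage, coe_mem_image_coe_Ico_iff ha]
    constructor
    · rintro ⟨h, hx⟩
      rw [Int.fract_eq_self.2 hx] at h
      exact ⟨hx.1, h⟩
    · intro hx
      have hx1 : x ∈ Set.Ico (0 : ℝ) 1 := ⟨hx.1, hx.2.trans_le ha⟩
      exact ⟨by rw [Int.fract_eq_self.2 hx1]; exact hx.2, hx1⟩
  rw [this, Real.volume_Ico, sub_zero]

theorem volume_singleton_unitAddCircle (x : UnitAddCircle) : volume {x} = 0 := by
  rw [← Metric.closedBall_zero, AddCircle.volume_closedBall]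
  simp

theorem empiricalMeasure_real {E : Type*} [MeasurableSpace E] (t : ℕ → E) (N : ℕ) {s : Set E}
    (hs : MeasurableSet s) : (empiricalMeasure t N).real s =
      (1 / ((N + 1 : ℕ) : ℝ)) * ∑ n ∈ Finset.range (N + 1), s.indicator (fun _ => (1 : ℝ)) (t n) := by
  have h : ∀ n, s.indicator (1 : E → ENNReal) (t n)
      = ENNReal.ofReal (s.indicator (fun _ => (1 : ℝ)) (t n)) := by
    intro n
    by_cases hn : t n ∈ s <;> simp [hn]
  rw [Measure.real, empiricalMeasure, Measure.smul_apply, Measure.finsetSum_apply]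
  simp only [Measure.dirac_apply' _ hs, h, smul_eq_mul]
  rw [← ENNReal.ofReal_sum_of_nonneg fun n _ => Set.indicator_nonneg (fun _ _ => zero_le_one) _,
    ENNReal.toReal_mul, ENNReal.toReal_inv, ENNReal.toReal_natCast, ENNReal.toReal_ofReal
    (Finset.sum_nonneg fun n _ => Set.indicator_nonneg (fun _ _ => zero_le_one) _), one_div]

/-- Weyl's criterion: if all nontrivial exponential averages of a sequence of points of the circle
tend to zero, then the sequence is equidistributed. -/
theorem tendsto_freq_of_fourier {t : ℕ → UnitAddCircle}
    (ht : ∀ h : ℤ, h ≠ 0 → Tendsto (average fun n => fourier h (t n)) atTop (𝓝 0))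
    {a : ℝ} (ha0 : 0 ≤ a) (ha : a ≤ 1) :
    Tendsto (fun N : ℕ => (1 / (N : ℝ)) * ∑ n ∈ Finset.range N,
      (((↑) : ℝ → UnitAddCircle) '' Set.Ico 0 a).indicator (fun _ => (1 : ℝ)) (t n))
      atTop (𝓝 a) := by
  let ν : ℕ → ProbabilityMeasure UnitAddCircle := fun N => ⟨empiricalMeasure t N, inferInstance⟩
  let lim : ProbabilityMeasure UnitAddCircle := ⟨volume, inferInstance⟩
  have hν : Tendsto ν atTop (𝓝 lim) := by
    rw [ProbabilityMeasure.tendsto_iff_forall_integral_rclike_tendsto ℂ]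
    intro φ
    have := (tendsto_average_of_fourier ht φ.toContinuousMap).comp (tendsto_add_atTop_nat 1)
    refine this.congr fun N => ?_
    exact (integral_empiricalMeasure t N φ.continuous.stronglyMeasurable).symm
  have hfr : volume (frontier (((↑) : ℝ → UnitAddCircle) '' Set.Ico 0 a)) = 0 := by
    refine measure_mono_null (frontier_image_coe_Ico_subset a) ?_
    rw [Set.insert_eq]
    exact measure_union_null (volume_singleton_unitAddCircle _) (volume_singleton_unitAddCircle _)
  have key := ProbabilityMeasure.tendsto_measure_of_null_frontier_of_tendsto' hν hfr
  have key2 := (ENNReal.tendsto_toReal (measure_ne_top _ _)).comp key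
  -- `empiricalMeasure t N` averages `N + 1` terms, so that it is a probability measure for every
  -- `N`.
  rw [← tendsto_add_atTop_iff_nat 1]
  have hl : ((lim : Measure UnitAddCircle) (((↑) : ℝ → UnitAddCircle) '' Set.Ico 0 a)).toReal
      = a := by
    show (volume (((↑) : ℝ → UnitAddCircle) '' Set.Ico 0 a)).toReal = a
    rw [volume_image_coe_Ico ha, ENNReal.toReal_ofReal ha0]
  rw [hl] at key2
  exact key2.congr fun N => empiricalMeasure_real t N (measurableSet_image_coe_Ico a)

end Weyl

/-! ### From mantissae to characters of the circle -/

section Mantissa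

theorem logb_mantissa {b x : ℝ} (hb : 1 < b) (hx : 0 < x) :
    Real.logb b (mantissa b x) = Int.fract (Real.logb b x) := by
  have hb0 : 0 < b := by linarith
  rw [mantissa, Real.logb_div hx.ne' (zpow_pos hb0 _).ne', ← Real.rpow_intCast,
    Real.logb_rpow hb0 hb.ne']
  rfl

theorem mantissa_mem_Ico_iff {b x a : ℝ} (hb : 1 < b) (hx : 0 < x) (ha : 1 ≤ a) :
    mantissa b x ∈ Set.Ico 1 a ↔ Int.fract (Real.logb b x) < Real.logb b a := by
  obtain ⟨⟨h1, -⟩, -⟩ := mantissa_spec hb hx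
  rw [← logb_mantissa hb hx, Real.logb_lt_logb_iff hb (by linarith) (by linarith)]
  exact ⟨fun h => h.2, fun h => ⟨h1, h⟩⟩

theorem isBenfordSeq_of_fourier {b : ℝ} (hb : 1 < b) {u : ℕ → ℝ} (hu : ∀ n, 0 < u n)
    (h : ∀ h : ℤ, h ≠ 0 →
      Tendsto (average fun n => fourier h ((Real.logb b (u n) : ℝ) : UnitAddCircle))
        atTop (𝓝 0)) :
    IsBenfordSeq b u := by
  intro a ha hab
  -- Benford frequencies count the indices from `1` to `N`, whereas `average` starts at `0`; the
  -- shift changes the sums by at most `2`.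
  have hshift : ∀ h : ℤ, h ≠ 0 →
      Tendsto (average fun n => fourier h ((Real.logb b (u (n + 1)) : ℝ) : UnitAddCircle))
        atTop (𝓝 0) := by
    intro j hj
    set v : ℕ → ℂ := fun n => fourier j ((Real.logb b (u n) : ℝ) : UnitAddCircle)
    have hv1 : ∀ n, ‖v n‖ ≤ 1 := fun n => (Circle.norm_coe _).le
    have h1 : Tendsto (fun N => average (fun n => v (n + 1)) N - average v N) atTop (𝓝 0) := by
      have h2 : Tendsto (fun N : ℕ => 2 * ((N : ℝ))⁻¹) atTop (𝓝 0) := by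
        simpa using (tendsto_inv_atTop_nhds_zero_nat (𝕜 := ℝ)).const_mul 2
      refine squeeze_zero_norm (fun N => ?_) h2
      rw [average, average, ← mul_sub, norm_mul, norm_inv, Complex.norm_natCast, mul_comm]
      have := norm_sum_range_shift_sub_le hv1 N 1
      gcongr
      simpa using this
    have h3 := h1.add (show Tendsto (average v) atTop (𝓝 0) from h j hj)
    simp only [sub_add_cancel, zero_add] at h3
    exact h3
  have hl : Real.logb b a ≤ 1 := by
    rw [Real.logb_le_iff_le_rpow hb (by linarith), Real.rpow_one]; exact hab.le
  refine (tendsto_freq_of_fourier hshift (Real.logb_nonneg hb ha) hl).congr fun N => ?_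
  rw [Finset.range_eq_Ico, Finset.sum_Ico_add'
    (fun n => (((↑) : ℝ → UnitAddCircle) '' Set.Ico 0 (Real.logb b a)).indicator
      (fun _ => (1 : ℝ)) ((Real.logb b (u n) : ℝ) : UnitAddCircle)) 0 N 1]
  congr 1
  refine Finset.sum_congr (by ext; simp) fun n _ => ?_
  have := (coe_mem_image_coe_Ico_iff hl (Real.logb b (u n))).trans
    (mantissa_mem_Ico_iff hb (hu n) ha).symm
  by_cases hm : mantissa b (u n) ∈ Set.Ico 1 a
  · rw [Set.indicator_of_mem hm, Set.indicator_of_mem (this.2 hm)]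
  · rw [Set.indicator_of_notMem hm, Set.indicator_of_notMem (mt this.1 hm)]

/-- Weak convergence is tested on continuous functions on all of `ℝ`. Truncating at `1` avoids the
singularity of the logarithm and changes nothing on mantissae. -/
theorem continuous_coe_logb_max (b : ℝ) :
    Continuous (fun y : ℝ => ((Real.logb b (max y 1) : ℝ) : UnitAddCircle)) := by
  refine (AddCircle.continuous_mk' 1).comp (Continuous.div_const (Continuous.log (by fun_prop)
    fun y => ?_) _)
  have : (1 : ℝ) ≤ max y 1 := le_max_right _ _
  linarith

theorem integral_fourier_benfordLaw {b : ℝ} (hb : 1 < b) {h : ℤ} (hh : h ≠ 0) :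
    ∫ y, fourier h ((Real.logb b (max y 1) : ℝ) : UnitAddCircle) ∂benfordLaw b = 0 := by
  have hb0 : 0 < b := by linarith
  have hc : Continuous (fun y : ℝ => fourier h ((Real.logb b (max y 1) : ℝ) : UnitAddCircle)) :=
    (fourier h).continuous.comp (continuous_coe_logb_max b)
  rw [benfordLaw, integral_map (measurable_const_rpow b).aemeasurable hc.aestronglyMeasurable]
  have h1 : ∫ t in Set.Ico (0 : ℝ) 1,
      fourier h ((Real.logb b (max (b ^ t) 1) : ℝ) : UnitAddCircle)
      = ∫ t in Set.Ico (0 : ℝ) 1, fourier h (t : UnitAddCircle) := by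
    refine setIntegral_congr_fun measurableSet_Ico fun t ht => ?_
    have : max (b ^ t) 1 = b ^ t := max_eq_left (Real.one_le_rpow hb.le ht.1)
    simp only [this, Real.logb_rpow hb0 hb.ne']
  rw [h1, integral_Ico_eq_integral_Ioc]
  have h2 := UnitAddCircle.integral_preimage 0 (fun x => fourier h x)
  rw [zero_add] at h2
  rw [h2]
  exact integral_eq_zero_of_add_right_eq_neg (fourier_add_half_inv_index (T := 1) hh one_pos)

theorem fourier_logb_mantissa {b x : ℝ} (hb : 1 < b) (hx : 0 < x) (h : ℤ) :
    fourier h ((Real.logb b (max (mantissa b x) 1) : ℝ) : UnitAddCircle) =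
      fourier h ((Real.logb b x : ℝ) : UnitAddCircle) := by
  rw [max_eq_left (mantissa_spec hb hx).1.1, logb_mantissa hb hx, AddCircle.coe_fract]

variable {Ω : Type*} [MeasurableSpace Ω] {P : Measure Ω} [IsProbabilityMeasure P]

/-- The character depends on `log_b Z n` only modulo one, hence only on the mantissa, where it is a
bounded continuous test function whose integral against `μ_b` vanishes. -/
theorem TendsToBenford.tendsto_integral_fourier {b : ℝ} (hb : 1 < b) {Z : ℕ → Ω → ℝ}
    (hZ0 : ∀ n, ∀ᵐ ω ∂P, 0 < Z n ω) (hZ : TendsToBenford P b Z) {h : ℤ} (hh : h ≠ 0) :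
    Tendsto (fun n => ∫ ω, fourier h ((Real.logb b (Z n ω) : ℝ) : UnitAddCircle) ∂P)
      atTop (𝓝 0) := by
  have hc : Continuous (fun y : ℝ => fourier h ((Real.logb b (max y 1) : ℝ) : UnitAddCircle)) :=
    (fourier h).continuous.comp (continuous_coe_logb_max b)
  have hlim := (ProbabilityMeasure.tendsto_iff_forall_integral_rclike_tendsto ℂ).1 hZ.tendsto
    (BoundedContinuousFunction.ofNormedAddCommGroup _ hc 1
      fun y => by rw [fourier_apply, Circle.norm_coe])
  simp only [BoundedContinuousFunction.coe_ofNormedAddCommGroup, ProbabilityMeasure.coe_mk,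
    Measure.map_id] at hlim
  rw [integral_fourier_benfordLaw hb hh] at hlim
  refine hlim.congr fun n => ?_
  rw [integral_map (hZ.forall_aemeasurable n) hc.aestronglyMeasurable]
  refine integral_congr_ae ?_
  filter_upwards [hZ0 n] with ω hω using fourier_logb_mantissa hb hω h

end Mantissa

/-! ### The shift and the cocycle of partial products -/

section Stationary

/-- The shift on sequences. -/
def shift (x : ℕ → ℝ) (n : ℕ) : ℝ := x (n + 1)

theorem iterate_shift_apply (k : ℕ) (x : ℕ → ℝ) (n : ℕ) : shift^[k] x n = x (n + k) := by
  induction k generalizing x with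
  | zero => rfl
  | succ k ih => rw [Function.iterate_succ_apply, ih, shift]; congr 1

theorem measurable_shift : Measurable shift :=
  measurable_pi_lambda _ fun n => measurable_pi_apply (n + 1)

/-- The logarithm turns products of positive factors into sums and the character turns sums back
into products, so the partial products generate a cocycle over the shift. -/
theorem cocycle_shift_fourier {Ω : Type*} (b : ℝ) (h : ℤ) {X : ℕ → Ω → ℝ} {ω : Ω}
    (hω : ∀ n, 0 < X n ω)
    (n : ℕ) :
    cocycle shift (fun x => fourier h ((Real.logb b (x 0) : ℝ) : UnitAddCircle)) n
      (fun n => X n ω) = fourier h ((Real.logb b (partialProd X n ω) : ℝ) : UnitAddCircle) := by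
  induction n with
  | zero => simp [cocycle, partialProd]
  | succ n ih =>
    have h1 : 0 < partialProd X n ω := Finset.prod_pos fun k _ => hω k
    have h2 : partialProd X (n + 1) ω = partialProd X n ω * X n ω := Finset.prod_range_succ _ _
    have h3 : ∀ y z : UnitAddCircle, fourier h (y + z) = fourier h y * fourier h z := by
      intro y z
      simp only [fourier_apply, smul_add, AddCircle.toCircle_add, Circle.coe_mul]
    rw [h2, Real.logb_mul h1.ne' (hω n).ne', AddCircle.coe_add, h3, ← ih, cocycle, cocycle,
      Finset.prod_range_succ]
    simp only [iterate_shift_apply, zero_add]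

theorem IsStationary.measurePreserving_shift {Ω : Type*} [MeasurableSpace Ω]
    {P : Measure Ω} {X : ℕ → Ω → ℝ} (hX : ∀ n, Measurable (X n))
    (hs : IsStationary P X) :
    MeasurePreserving shift (P.map fun ω n => X n ω) (P.map fun ω n => X n ω) := by
  refine ⟨measurable_shift, ?_⟩
  rw [Measure.map_map measurable_shift (measurable_pi_lambda _ hX)]
  exact (hs 1).map_eq

end Stationary

end Benford

/-! ### The almost sure Benford property -/

theorem corollary1 {Ω : Type*} [MeasurableSpace Ω] (P : Measure Ω) [IsProbabilityMeasure P]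
    (b : ℝ) (hb : 1 < b) (X : ℕ → Ω → ℝ)
    (hX_meas : ∀ n, Measurable (X n))
    (hX_pos : ∀ n, ∀ᵐ ω ∂P, 0 < X n ω)
    (hX_stat : Benford.IsStationary P X)
    (hY : Benford.TendsToBenford P b (Benford.partialProd X)) :
    Benford.IsASBenford P b (Benford.partialProd X) := by
  have hpos := ae_all_iff.2 hX_pos
  have hXm : Measurable (fun ω n => X n ω) := measurable_pi_lambda _ hX_meas
  have hprob : IsProbabilityMeasure (P.map fun ω n => X n ω) :=
    Measure.isProbabilityMeasure_map hXm.aemeasurable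
  have hT := hX_stat.measurePreserving_shift hX_meas
  have hYpos : ∀ n, ∀ᵐ ω ∂P, 0 < Benford.partialProd X n ω := fun n => by
    filter_upwards [hpos] with ω hω using Finset.prod_pos fun k _ => hω k
  have key : ∀ h : ℤ, h ≠ 0 → ∀ᵐ ω ∂P, Tendsto (Benford.average fun n =>
      fourier h ((Real.logb b (Benford.partialProd X n ω) : ℝ) : UnitAddCircle))
        atTop (𝓝 0) := by
    intro h hh
    set f : (ℕ → ℝ) → ℂ := fun x => fourier h ((Real.logb b (x 0) : ℝ) : UnitAddCircle)
    have hf : Measurable f := (fourier h).continuous.measurable.comp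
      (AddCircle.measurable_mk'.comp
        ((Real.measurable_log.comp (measurable_pi_apply 0)).div_const _))
    have hf1 : ∀ x, ‖f x‖ = 1 := fun x => Circle.norm_coe _
    have hlim : Tendsto (fun n => ∫ x, Benford.cocycle Benford.shift f n x
        ∂(P.map fun ω n => X n ω)) atTop (𝓝 0) := by
      refine (hY.tendsto_integral_fourier hb hYpos hh).congr fun n => ?_
      rw [integral_map hXm.aemeasurable
        (Benford.measurable_cocycle Benford.measurable_shift hf n).aestronglyMeasurable]
      refine integral_congr_ae ?_
      filter_upwards [hpos] with ω hω using (Benford.cocycle_shift_fourier b h hω n).symm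
    filter_upwards [hpos, ae_of_ae_map hXm.aemeasurable
      (Benford.ae_tendsto_average_cocycle hT hf hf1 hlim)] with ω hω hlimω
    simpa only [f, Benford.cocycle_shift_fourier b h hω] using hlimω
  -- There are countably many frequencies, so one null set serves for all of them, and Weyl's
  -- criterion then covers every `a` at once.
  have key' : ∀ᵐ ω ∂P, ∀ h : ℤ, h ≠ 0 → Tendsto (Benford.average fun n =>
      fourier h ((Real.logb b (Benford.partialProd X n ω) : ℝ) : UnitAddCircle))
        atTop (𝓝 0) := by
    rw [ae_all_iff]
    intro h
    by_cases hh : h = 0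
    · exact ae_of_all _ fun _ h0 => absurd hh h0
    · filter_upwards [key h hh] with ω hω _ using hω
  filter_upwards [hpos, key'] with ω hω hk
  exact Benford.isBenfordSeq_of_fourier hb (fun n => Finset.prod_pos fun k _ => hω k) hk
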